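/- For $\mathbb K\in\{\mathbb R,\mathbb C\}$ let $C^\infty(\mathbb R)$ be the Fréchet space of infinitely differentiable functions $F:\mathbb R\to\mathbb K$ with the seminorms $\|F\|_n=\sup\{|F^{(j)}(x)|: |x|\le n,\ 0\le j\le n\}$, $n\in\mathbb N_0$. For a compact set $K\subseteq\mathbb R$ endow the space $C^\infty(K)=\{F|_K: F\in C^\infty(\mathbb R)\}$ with the quotient topology induced by the surjective restriction map $R:C^\infty(\mathbb R)\to C^\infty(K)$, $F\mapsto F|_K$. One says that $K$ has the smooth extension property if there is a continuous linear map $E:C^\infty(K)\to C^\infty(\mathbb R)$ such that $R\circ E=\mathrm{Id}_{C^\infty(K)}$, that is, $E(f)|_K=f$ for all $f\in C^\infty(K)$. The compact set $$K=\{0\}\cup\Big\{\tfrac1k+je^{-k}:\ k,j\in\mathbb Z,\ k\ge 1,\ 0\le j\le k\Big\}$$ does not have the smooth extension property. -/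

import Mathlib

open scoped ContDiff

noncomputable section

namespace SmoothExtension

variable (𝕜 : Type*) [RCLike 𝕜]

/-- The infinitely differentiable functions `ℝ → 𝕜`, as a subspace of all functions. -/
def smoothSubmodule : Submodule 𝕜 (ℝ → 𝕜) where
  carrier := {F | ContDiff ℝ ∞ F}
  add_mem' {F G} (hF : ContDiff ℝ ∞ F) (hG : ContDiff ℝ ∞ G) := hF.add hG
  zero_mem' := (contDiff_const : ContDiff ℝ ∞ fun _ : ℝ => (0 : 𝕜))
  smul_mem' c F (hF : ContDiff ℝ ∞ F) :=
    ((contDiff_const : ContDiff ℝ ∞ fun _ : ℝ => c).mul hF : ContDiff ℝ ∞ fun x => c * F x)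

/-- The space `C^∞(ℝ)`. It is a type of its own (a plain `def`), so that it does not inherit the
topology of pointwise convergence. -/
def SmoothFun : Type _ := smoothSubmodule 𝕜

instance : AddCommGroup (SmoothFun 𝕜) := inferInstanceAs (AddCommGroup (smoothSubmodule 𝕜))

instance : Module 𝕜 (SmoothFun 𝕜) := inferInstanceAs (Module 𝕜 (smoothSubmodule 𝕜))

instance : CoeFun (SmoothFun 𝕜) (fun _ => ℝ → 𝕜) := ⟨fun F => F.1⟩

variable {𝕜} in
theorem SmoothFun.contDiff (F : SmoothFun 𝕜) : ContDiff ℝ ∞ F := F.2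

/-- The `j`-th derivative, restricted to `[-n, n]`, as a linear map from `C^∞(ℝ)` to the space of
continuous functions on `[-n, n]`. -/
def derivOn (n j : ℕ) : SmoothFun 𝕜 →ₗ[𝕜] C(Set.Icc (-(n : ℝ)) n, 𝕜) where
  toFun F := ⟨fun x => iteratedDeriv j F x,
    (F.contDiff.continuous_iteratedDeriv j (by exact_mod_cast le_top)).comp
      continuous_subtype_val⟩
  map_add' F G := by
    ext x
    exact iteratedDeriv_add (F.contDiff.contDiffAt.of_le (by exact_mod_cast le_top))
      (G.contDiff.contDiffAt.of_le (by exact_mod_cast le_top))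
  map_smul' c F := by
    ext x
    exact iteratedDeriv_const_smul_field c F

/-- The seminorms `‖F‖_n = sup {|F^(j)(x)| : |x| ≤ n, 0 ≤ j ≤ n}` on `C^∞(ℝ)`
(the norm on `C([-n, n])` is the supremum norm). -/
def smoothSeminorm : SeminormFamily 𝕜 (SmoothFun 𝕜) ℕ := fun n =>
  (Finset.range (n + 1)).sup fun j =>
    (normSeminorm 𝕜 C(Set.Icc (-(n : ℝ)) n, 𝕜)).comp (derivOn 𝕜 n j)

/-- The Fréchet space topology of `C^∞(ℝ)`, given by the seminorms `‖·‖_n`. -/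
instance : TopologicalSpace (SmoothFun 𝕜) := (smoothSeminorm 𝕜).moduleFilterBasis.topology

/-- Restriction of smooth functions to `K`, with values in all functions on `K`. -/
def restrictₗ (K : Set ℝ) : SmoothFun 𝕜 →ₗ[𝕜] (K → 𝕜) where
  toFun F := fun x => F x
  map_add' _ _ := rfl
  map_smul' _ _ := rfl

/-- The space `C^∞(K) = {F|_K : F ∈ C^∞(ℝ)}` of smooth restrictions (again a type of its own). -/
def SmoothRestr (K : Set ℝ) : Type _ := LinearMap.range (restrictₗ 𝕜 K)

instance (K : Set ℝ) : AddCommGroup (SmoothRestr 𝕜 K) :=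
  inferInstanceAs (AddCommGroup (LinearMap.range (restrictₗ 𝕜 K)))

instance (K : Set ℝ) : Module 𝕜 (SmoothRestr 𝕜 K) :=
  inferInstanceAs (Module 𝕜 (LinearMap.range (restrictₗ 𝕜 K)))

/-- The surjective restriction operator `R : C^∞(ℝ) → C^∞(K)`. -/
def restrict (K : Set ℝ) : SmoothFun 𝕜 →ₗ[𝕜] SmoothRestr 𝕜 K := (restrictₗ 𝕜 K).rangeRestrict

/-- The quotient topology on `C^∞(K)` with respect to the restriction operator. -/
instance (K : Set ℝ) : TopologicalSpace (SmoothRestr 𝕜 K) :=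
  TopologicalSpace.coinduced (restrict 𝕜 K) inferInstance

/-- `K` has the smooth extension property: there is a continuous linear operator
`E : C^∞(K) → C^∞(ℝ)` with `R ∘ E = id`. -/
def HasSmoothExtensionProperty (K : Set ℝ) : Prop :=
  ∃ E : SmoothRestr 𝕜 K →L[𝕜] SmoothFun 𝕜, ∀ f : SmoothRestr 𝕜 K, restrict 𝕜 K (E f) = f

/-- The set `{0} ∪ {1/k + j e^{-k} : 0 ≤ j ≤ k, k ≥ 1}`. -/
def clusterSet : Set ℝ :=
  {0} ∪ {x | ∃ k j : ℕ, 1 ≤ k ∧ j ≤ k ∧ x = 1 / (k : ℝ) + (j : ℝ) * Real.exp (-(k : ℝ))}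

end SmoothExtension

end

open scoped ContDiff

noncomputable section

namespace SmoothExtension

/-! ### Finite differences versus derivatives -/

section FiniteDifferences

variable {E : Type*} [NormedAddCommGroup E] [NormedSpace ℝ E]

/-! The clusters of the set are exponentially short (`k * exp (-k)`), while the gaps around them are
only polynomially small (about `1 / k ^ 2`). Given an extension operator `E`, the operator `E ∘ R`
satisfies `‖·‖_1 ≤ C₀ ‖·‖_p` and `‖·‖_{n+1} ≤ C₁ ‖·‖_q` with `n = p + 1`. Cut off `(x - 1/k) ^ n` at
the scale of the cluster or at the scale of the gap: both functions have the same restriction, hence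
the same image `G`. The short cutoff makes `G` exponentially small, the long one bounds its
derivative of order `n + 1` by a power of `k`.

Since `G` interpolates the power at `n + 1` points of the cluster, its `n`-th derivative at `1/k` is
close to `n!`. Finite differences with a polynomially small step show that this derivative is also
close to `0` (`factorial_le_of_eq_pow`), a contradiction as `k → ∞`. -/

theorem norm_iteratedDeriv_add_sub_le {G : ℝ → E} (hG : ContDiff ℝ ∞ G) (n : ℕ) {x h B : ℝ}
    (hh : 0 ≤ h) (hB : ∀ y ∈ Set.Icc x (x + h), ‖iteratedDeriv (n + 1) G y‖ ≤ B) :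
    ∀ y ∈ Set.Icc x (x + h), ‖iteratedDeriv n G y - iteratedDeriv n G x‖ ≤ h * B := by
  intro y hy
  have hd : Differentiable ℝ (iteratedDeriv n G) :=
    hG.differentiable_iteratedDeriv n (by exact_mod_cast ENat.natCast_lt_top n)
  have hx : x ∈ Set.Icc x (x + h) := ⟨le_rfl, by linarith⟩
  have h1 := (convex_Icc x (x + h)).norm_image_sub_le_of_norm_deriv_le (𝕜 := ℝ)
    (fun z _ => hd z) (C := B) (fun z hz => by rw [← iteratedDeriv_succ]; exact hB z hz) hx hy
  refine h1.trans ?_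
  have hB0 : 0 ≤ B := (norm_nonneg _).trans (hB x hx)
  rw [Real.norm_eq_abs, abs_of_nonneg (by linarith [hy.1]), mul_comm]
  exact mul_le_mul_of_nonneg_right (by linarith [hy.2]) hB0

theorem norm_iteratedDeriv_add_sub_sub_le {G : ℝ → E} (hG : ContDiff ℝ ∞ G) (n : ℕ) {x h B : ℝ}
    (hh : 0 ≤ h) (hB : ∀ y ∈ Set.Icc x (x + h), ‖iteratedDeriv (n + 2) G y‖ ≤ B) :
    ‖iteratedDeriv n G (x + h) - iteratedDeriv n G x - h • iteratedDeriv (n + 1) G x‖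
      ≤ h * (h * B) := by
  have hd : Differentiable ℝ (iteratedDeriv n G) :=
    hG.differentiable_iteratedDeriv n (by exact_mod_cast ENat.natCast_lt_top n)
  have hx : x ∈ Set.Icc x (x + h) := ⟨le_rfl, by linarith⟩
  have hxh : x + h ∈ Set.Icc x (x + h) := ⟨by linarith, le_rfl⟩
  have hder : ∀ z, HasDerivAt (fun z => iteratedDeriv n G z - z • iteratedDeriv (n + 1) G x)
      (iteratedDeriv (n + 1) G z - iteratedDeriv (n + 1) G x) z := fun z => by
    have h1 := (hd z).hasDerivAt
    rw [← iteratedDeriv_succ] at h1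
    have h2 := h1.sub ((hasDerivAt_id z).smul_const (iteratedDeriv (n + 1) G x))
    rwa [one_smul] at h2
  have h1 := (convex_Icc x (x + h)).norm_image_sub_le_of_norm_hasDerivWithin_le
    (fun z _ => (hder z).hasDerivWithinAt)
    (fun z hz => norm_iteratedDeriv_add_sub_le hG (n + 1) hh hB z hz) hx hxh
  rw [Real.norm_eq_abs, add_sub_cancel_left, abs_of_nonneg hh, mul_comm (h * B)] at h1
  refine le_trans (le_of_eq ?_) h1
  congr 1
  module

theorem iteratedDeriv_fwdDiff {G : ℝ → E} (hG : ContDiff ℝ ∞ G) (n : ℕ) (h x : ℝ) :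
    iteratedDeriv n (fwdDiff h G) x = iteratedDeriv n G (x + h) - iteratedDeriv n G x := by
  have hn : ContDiff ℝ n G := hG.of_le (by exact_mod_cast le_top)
  have hs : ContDiff ℝ n fun z => G (z + h) := hn.comp (contDiff_id.add contDiff_const)
  have : fwdDiff h G = (fun z => G (z + h)) - G := rfl
  rw [this, iteratedDeriv_sub hs.contDiffAt hn.contDiffAt, iteratedDeriv_comp_add_const]

/-- Induction on `n`, applied to the difference `fwdDiff h G`: by the mean value inequality its
derivatives gain a factor `h`, so `B` becomes `h * B`. -/
theorem norm_fwdDiff_iter_sub_le (n : ℕ) {G : ℝ → E} (hG : ContDiff ℝ ∞ G) {x h B : ℝ}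
    (hh : 0 ≤ h) (hB : ∀ y ∈ Set.Icc x (x + n * h), ‖iteratedDeriv (n + 1) G y‖ ≤ B) :
    ‖(fwdDiff h)^[n] G x - h ^ n • iteratedDeriv n G x‖ ≤ n * h ^ (n + 1) * B := by
  induction n generalizing G B with
  | zero => simp
  | succ n ih =>
    push_cast at hB ⊢
    have hnh : 0 ≤ (n : ℝ) * h := by positivity
    have hG' : ContDiff ℝ ∞ (fwdDiff h G) :=
      (hG.comp (contDiff_id.add contDiff_const)).sub hG
    have h1 := ih (B := h * B) hG' fun y hy => by
      rw [iteratedDeriv_fwdDiff hG]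
      refine norm_iteratedDeriv_add_sub_le hG (n + 1) hh (fun z hz => hB z ⟨?_, ?_⟩) _
        ⟨by linarith, le_rfl⟩
      · linarith [hy.1, hz.1]
      · linarith [hy.2, hz.2]
    have h2 := norm_iteratedDeriv_add_sub_sub_le hG n hh
      (fun z hz => hB z ⟨hz.1, by linarith [hz.2]⟩)
    rw [iteratedDeriv_fwdDiff hG] at h1
    rw [Function.iterate_succ_apply]
    calc ‖(fwdDiff h)^[n] (fwdDiff h G) x - h ^ (n + 1) • iteratedDeriv (n + 1) G x‖
        = ‖((fwdDiff h)^[n] (fwdDiff h G) x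
              - h ^ n • (iteratedDeriv n G (x + h) - iteratedDeriv n G x))
            + h ^ n • (iteratedDeriv n G (x + h) - iteratedDeriv n G x
              - h • iteratedDeriv (n + 1) G x)‖ := by
          congr 1
          module
      _ ≤ n * h ^ (n + 1) * (h * B) + h ^ n * (h * (h * B)) := by
          refine (norm_add_le _ _).trans (add_le_add h1 ?_)
          rw [norm_smul, Real.norm_eq_abs, abs_of_nonneg (by positivity)]
          exact mul_le_mul_of_nonneg_left h2 (by positivity)
      _ = (n + 1) * h ^ (n + 1 + 1) * B := by ring

theorem norm_fwdDiff_iter_le {E : Type*} [SeminormedAddCommGroup E] (n : ℕ) {G : ℝ → E} {x h S : ℝ} (hh : 0 ≤ h)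
    (hS : ∀ y ∈ Set.Icc x (x + n * h), ‖G y‖ ≤ S) :
    ‖(fwdDiff h)^[n] G x‖ ≤ 2 ^ n * S := by
  induction n generalizing x with
  | zero => simpa using hS x
  | succ n ih =>
    push_cast at hS
    have hnh : 0 ≤ (n : ℝ) * h := by positivity
    rw [Function.iterate_succ_apply', fwdDiff]
    have h1 := ih (x := x) fun y hy => hS y ⟨hy.1, by linarith [hy.2]⟩
    have h2 := ih (x := x + h) fun y hy => hS y ⟨by linarith [hy.1], by linarith [hy.2]⟩
    calc _ ≤ 2 ^ n * S + 2 ^ n * S := (norm_sub_le _ _).trans (add_le_add h2 h1)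
      _ = 2 ^ (n + 1) * S := by ring

/-- If `G` agrees with `(· - x) ^ n` at `n + 1` points with spacing `ε`, then its
size and the size of its derivative of order `n + 1` cannot both be small. -/
theorem factorial_le_of_eq_pow {𝕜 : Type*} [RCLike 𝕜] (n : ℕ) {G : ℝ → 𝕜} (hG : ContDiff ℝ ∞ G)
    {x ε h b B S : ℝ} (hε : 0 < ε) (hh : 0 < h) (hεb : x + n * ε ≤ b) (hhb : x + n * h ≤ b)
    (hB : ∀ y ∈ Set.Icc x b, ‖iteratedDeriv (n + 1) G y‖ ≤ B)
    (hS : ∀ y ∈ Set.Icc x b, ‖G y‖ ≤ S)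
    (hpow : ∀ j ≤ n, G (x + j * ε) = (((j * ε) ^ n : ℝ) : 𝕜)) :
    (n.factorial : ℝ) ≤ n * ε * B + n * h * B + 2 ^ n * S * h⁻¹ ^ n := by
  -- The difference uses only the nodes `x + j * ε`, so it is `ε ^ n` times the `n`-th unit-step
  -- difference of `t ^ n` at `0`, which is `n!`.
  have key : (fwdDiff ε)^[n] G x = ((ε ^ n * n.factorial : ℝ) : 𝕜) := by
    have h1 := congrFun (fwdDiff_iter_eq_factorial (R := ℝ) (n := n)) 0
    rw [fwdDiff_iter_eq_sum_shift] at h1 ⊢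
    have h2 : (n.factorial : ℝ) = ((n.factorial : ℝ → ℝ)) 0 := by simp
    rw [h2, ← h1, Finset.mul_sum, RCLike.ofReal_sum]
    refine Finset.sum_congr rfl fun j hj => ?_
    rw [nsmul_eq_mul, hpow j (Nat.lt_succ_iff.1 (Finset.mem_range.1 hj))]
    simp only [zsmul_eq_mul, nsmul_eq_mul, zero_add, mul_one, mul_pow]
    push_cast
    ring
  have hε' := norm_fwdDiff_iter_sub_le n hG hε.le
    (fun y hy => hB y ⟨hy.1, hy.2.trans hεb⟩)
  have hh' := norm_fwdDiff_iter_sub_le n hG hh.le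
    (fun y hy => hB y ⟨hy.1, hy.2.trans hhb⟩)
  have hS' := norm_fwdDiff_iter_le n hh.le (fun y hy => hS y ⟨hy.1, hy.2.trans hhb⟩)
  -- The step `ε` bounds the `n`-th derivative at `x` from below; the step `h` in `e2` bounds it
  -- from above.
  have e1 : ε ^ n * n.factorial ≤ ε ^ n * (‖iteratedDeriv n G x‖ + n * ε * B) := by
    rw [key] at hε'
    have := norm_sub_norm_le ((ε ^ n * n.factorial : ℝ) : 𝕜) (ε ^ n • iteratedDeriv n G x)
    rw [norm_smul, RCLike.norm_ofReal, Real.norm_eq_abs, abs_of_nonneg (by positivity),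
      abs_of_nonneg (by positivity)] at this
    linarith [this.trans hε', show ε ^ n * (n * ε * B) = n * ε ^ (n + 1) * B by ring]
  have e2 : h ^ n * ‖iteratedDeriv n G x‖ ≤ h ^ n * (n * h * B + 2 ^ n * S * h⁻¹ ^ n) := by
    have := norm_sub_norm_le (h ^ n • iteratedDeriv n G x) ((fwdDiff h)^[n] G x)
    rw [norm_smul, Real.norm_eq_abs, abs_of_nonneg (by positivity), norm_sub_rev] at this
    have h3 : h ^ n * (n * h * B + 2 ^ n * S * h⁻¹ ^ n) = n * h ^ (n + 1) * B + 2 ^ n * S := by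
      have : h ^ n * h⁻¹ ^ n = 1 := by rw [← mul_pow, mul_inv_cancel₀ hh.ne', one_pow]
      linear_combination (2 ^ n * S) * this
    linarith
  have f1 := le_of_mul_le_mul_left e1 (by positivity)
  have f2 := le_of_mul_le_mul_left e2 (by positivity)
  linarith

end FiniteDifferences

/-! ### Seminorm estimates for operators on `C^∞(ℝ)` -/

variable {𝕜 : Type*} [RCLike 𝕜]

theorem smoothSeminorm_le {n : ℕ} {F : SmoothFun 𝕜} {b : ℝ} (hb : 0 ≤ b)
    (h : ∀ j ≤ n, ∀ x ∈ Set.Icc (-(n : ℝ)) n, ‖iteratedDeriv j F x‖ ≤ b) :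
    smoothSeminorm 𝕜 n F ≤ b := by
  refine Seminorm.finset_sup_apply_le hb fun j hj => ?_
  refine (ContinuousMap.norm_le _ hb).2 fun x => ?_
  exact h j (Nat.lt_succ_iff.1 (Finset.mem_range.1 hj)) x x.2

theorem norm_iteratedDeriv_le_smoothSeminorm {n j : ℕ} (hj : j ≤ n) (F : SmoothFun 𝕜) {x : ℝ}
    (hx : x ∈ Set.Icc (-(n : ℝ)) n) : ‖iteratedDeriv j F x‖ ≤ smoothSeminorm 𝕜 n F := by
  have h1 := Seminorm.le_finset_sup_apply (x := F) (p := fun j =>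
    (normSeminorm 𝕜 C(Set.Icc (-(n : ℝ)) n, 𝕜)).comp (derivOn 𝕜 n j))
    (Finset.mem_range.2 (Nat.lt_succ_iff.2 hj))
  exact ((derivOn 𝕜 n j F).norm_coe_le_norm ⟨x, hx⟩).trans h1

theorem smoothSeminorm_mono : Monotone (smoothSeminorm 𝕜) := fun m n hmn F => by
  have : (m : ℝ) ≤ n := by exact_mod_cast hmn
  exact smoothSeminorm_le (apply_nonneg _ _) fun j hj x hx =>
    norm_iteratedDeriv_le_smoothSeminorm (hj.trans hmn) F
      ⟨by linarith [hx.1], by linarith [hx.2]⟩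

instance : IsTopologicalAddGroup (SmoothFun 𝕜) :=
  (smoothSeminorm 𝕜).addGroupFilterBasis.isTopologicalAddGroup

theorem withSeminorms_smoothSeminorm : WithSeminorms (smoothSeminorm 𝕜) := ⟨rfl⟩

/-- Continuous linear operators on `C^∞(ℝ)` satisfy estimates between the seminorms. -/
theorem exists_smoothSeminorm_le (T : SmoothFun 𝕜 →L[𝕜] SmoothFun 𝕜) (n : ℕ) :
    ∃ (p : ℕ) (C : ℝ), 0 ≤ C ∧ ∀ F, smoothSeminorm 𝕜 n (T F) ≤ C * smoothSeminorm 𝕜 p F := by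
  have hc : Continuous ((smoothSeminorm 𝕜 n).comp (T : SmoothFun 𝕜 →ₗ[𝕜] SmoothFun 𝕜)) :=
    (withSeminorms_smoothSeminorm.continuous_seminorm n).comp T.continuous
  obtain ⟨s, C, -, hC⟩ := Seminorm.bound_of_continuous withSeminorms_smoothSeminorm _ hc
  refine ⟨s.sup id, C, C.2, fun F => (hC F).trans ?_⟩
  refine mul_le_mul_of_nonneg_left ?_ C.2
  refine Seminorm.finset_sup_apply_le (apply_nonneg _ _) fun i hi => ?_
  exact smoothSeminorm_mono (Finset.le_sup (f := id) hi) F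

/-- The operator `E ∘ R` on `C^∞(ℝ)`. -/
def compRestrict {K : Set ℝ} (E : SmoothRestr 𝕜 K →L[𝕜] SmoothFun 𝕜) :
    SmoothFun 𝕜 →L[𝕜] SmoothFun 𝕜 where
  toLinearMap := (E : SmoothRestr 𝕜 K →ₗ[𝕜] SmoothFun 𝕜).comp (restrict 𝕜 K)
  cont := E.continuous.comp continuous_coinduced_rng

/-! ### Truncated powers and their scaling -/

theorem exists_truncated_pow (n : ℕ) : ∃ (Φ : ℝ → 𝕜) (C : ℕ → ℝ), ContDiff ℝ ∞ Φ ∧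
    (∀ t, |t| ≤ 1 → Φ t = ((t ^ n : ℝ) : 𝕜)) ∧ (∀ t, 2 ≤ |t| → Φ t = 0) ∧
    ∀ l t, ‖iteratedDeriv l Φ t‖ ≤ C l := by
  let χ : ContDiffBump (0 : ℝ) := ⟨1, 2, one_pos, one_lt_two⟩
  let Φ : ℝ → 𝕜 := fun t => ((t ^ n * χ t : ℝ) : 𝕜)
  have hΦ : ContDiff ℝ ∞ Φ :=
    (RCLike.ofRealCLM (K := 𝕜)).contDiff.comp ((contDiff_id.pow n).mul χ.contDiff)
  have hsupp : HasCompactSupport Φ :=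
    (χ.hasCompactSupport.mul_left (f := fun t : ℝ => t ^ n)).comp_left (g := RCLike.ofReal)
      RCLike.ofReal_zero
  have hb : ∀ l, ∃ C, ∀ t, ‖iteratedDeriv l Φ t‖ ≤ C := fun l => by
    obtain ⟨C, hC⟩ := (hsupp.iteratedFDeriv (𝕜 := ℝ) l).exists_bound_of_continuous
      (hΦ.continuous_iteratedFDeriv (by exact_mod_cast le_top))
    exact ⟨C, fun t => norm_iteratedFDeriv_eq_norm_iteratedDeriv (𝕜 := ℝ) (f := Φ) ▸ hC t⟩
  choose C hC using hb
  refine ⟨Φ, C, hΦ, fun t ht => ?_, fun t ht => ?_, hC⟩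
  · have : χ t = 1 := χ.one_of_mem_closedBall (by simpa [χ] using ht)
    simp [Φ, this]
  · have : χ t = 0 := χ.zero_of_le_dist (by simpa [χ] using ht)
    simp [Φ, this]

variable (𝕜) in
/-- Smooth functions `Ψ a δ` which equal `(x - a) ^ n` for `|x - a| ≤ δ` and vanish for
`|x - a| ≥ 2 δ`, with the scaling of the seminorms in `δ`. -/
theorem exists_scaled_truncated_pow (n : ℕ) : ∃ (Ψ : ℝ → ℝ → SmoothFun 𝕜) (C : ℕ → ℝ),
    (∀ l, 0 ≤ C l) ∧ ∀ a δ : ℝ, 0 < δ →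
      (∀ x, |x - a| ≤ δ → Ψ a δ x = (((x - a) ^ n : ℝ) : 𝕜)) ∧
      (∀ x, 2 * δ ≤ |x - a| → Ψ a δ x = 0) ∧
      (δ ≤ 1 → ∀ m, smoothSeminorm 𝕜 m (Ψ a δ) ≤ C m * (δ ^ n * δ⁻¹ ^ m)) := by
  obtain ⟨Φ, C, hΦ, hpow, hzero, hC⟩ := exists_truncated_pow (𝕜 := 𝕜) n
  have hC0 : ∀ l, 0 ≤ C l := fun l => (norm_nonneg _).trans (hC l 0)
  have hsm : ∀ a δ : ℝ, ContDiff ℝ ∞ fun x => ((δ ^ n : ℝ) : 𝕜) * Φ (δ⁻¹ * (x - a)) :=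
    fun a δ => contDiff_const.mul
      (hΦ.comp (contDiff_const.mul (contDiff_id.sub contDiff_const)))
  refine ⟨fun a δ => ⟨_, hsm a δ⟩, fun m => ∑ l ∈ Finset.range (m + 1), C l,
    fun m => Finset.sum_nonneg fun l _ => hC0 l, fun a δ hδ => ⟨fun x hx => ?_, fun x hx => ?_,
    fun hδ1 m => smoothSeminorm_le ?_ fun j hj x _ => ?_⟩⟩
  · change ((δ ^ n : ℝ) : 𝕜) * Φ (δ⁻¹ * (x - a)) = _
    rw [hpow, ← RCLike.ofReal_mul, ← mul_pow, mul_inv_cancel_left₀ hδ.ne']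
    rw [abs_mul, abs_of_pos (inv_pos.2 hδ), inv_mul_le_iff₀ hδ, mul_one]
    exact hx
  · change ((δ ^ n : ℝ) : 𝕜) * Φ (δ⁻¹ * (x - a)) = _
    rw [hzero, mul_zero]
    rw [abs_mul, abs_of_pos (inv_pos.2 hδ), le_inv_mul_iff₀ hδ, mul_comm]
    exact hx
  · have := Finset.sum_nonneg fun l (_ : l ∈ Finset.range (m + 1)) => hC0 l
    positivity
  · change ‖iteratedDeriv j (fun x => ((δ ^ n : ℝ) : 𝕜) * Φ (δ⁻¹ * (x - a))) x‖ ≤ _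
    have h1 : iteratedDeriv j (fun x => ((δ ^ n : ℝ) : 𝕜) * Φ (δ⁻¹ * (x - a))) x
        = ((δ ^ n : ℝ) : 𝕜) * (δ⁻¹ ^ j • iteratedDeriv j Φ (δ⁻¹ * (x - a))) := by
      have hj : ContDiff ℝ j Φ := hΦ.of_le (by exact_mod_cast le_top)
      have h2 := iteratedDeriv_comp_sub_const j (fun x => Φ (δ⁻¹ * x)) a
      rw [iteratedDeriv_const_mul_field, h2, iteratedDeriv_comp_const_smul hj]
    have hinv : 0 < δ⁻¹ := inv_pos.2 hδ
    rw [h1, norm_mul, norm_smul, RCLike.norm_ofReal, Real.norm_eq_abs,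
      abs_of_nonneg (by positivity), abs_of_nonneg (by positivity)]
    have h3 : C j ≤ ∑ l ∈ Finset.range (m + 1), C l :=
      Finset.single_le_sum (fun l _ => hC0 l) (Finset.mem_range.2 (Nat.lt_succ_iff.2 hj))
    have h4 : δ⁻¹ ^ j ≤ δ⁻¹ ^ m := pow_le_pow_right₀ ((one_le_inv₀ hδ).2 hδ1) hj
    calc δ ^ n * (δ⁻¹ ^ j * ‖iteratedDeriv j Φ (δ⁻¹ * (x - a))‖)
        ≤ δ ^ n * (δ⁻¹ ^ m * ∑ l ∈ Finset.range (m + 1), C l) := by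
          gcongr
          exact (hC j _).trans h3
      _ = _ := by ring

/-! ### Geometry of the cluster set -/

/-- For large `k`, the points of the `k`-th cluster have distance at least `1 / (4 k ^ 2)` from
the other points of the cluster set. -/
theorem clusterSet_separated : ∀ᶠ k : ℕ in Filter.atTop, ∀ x ∈ clusterSet,
    |x - 1 / (k : ℝ)| ≤ k * Real.exp (-k) ∨ 1 / (4 * (k : ℝ) ^ 2) ≤ |x - 1 / (k : ℝ)| := by
  have hlim : Filter.Tendsto (fun l : ℕ => (l : ℝ) ^ 3 * Real.exp (-l)) Filter.atTop (nhds 0) :=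
    (Real.tendsto_pow_mul_exp_neg_atTop_nhds_zero 3).comp tendsto_natCast_atTop_atTop
  obtain ⟨N, hN⟩ := Filter.eventually_atTop.1 (hlim.eventually_le_const (u := 1 / 4) (by norm_num))
  filter_upwards [Filter.eventually_ge_atTop (max N 1)] with k hk x hx
  have hk1 : (1 : ℝ) ≤ k := by exact_mod_cast (le_max_right _ _).trans hk
  have hk0 : (0 : ℝ) < k := by linarith
  rcases hx with rfl | ⟨l, j, hl, hj, rfl⟩
  · right
    rw [zero_sub, abs_neg, abs_of_pos (by positivity)]
    exact one_div_le_one_div_of_le hk0 (by nlinarith)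
  have hl1 : (1 : ℝ) ≤ l := by exact_mod_cast hl
  have hl0 : (0 : ℝ) < l := by linarith
  have hjl : (j : ℝ) ≤ l := by exact_mod_cast hj
  have hje : (j : ℝ) * Real.exp (-l) ≤ l * Real.exp (-l) := by gcongr
  have hje0 : 0 ≤ (j : ℝ) * Real.exp (-l) := by positivity
  rcases lt_trichotomy l k with h | rfl | h
  · right
    have hlk : (l : ℝ) + 1 ≤ k := by exact_mod_cast h
    refine le_trans ?_ (le_abs_self _)
    have h1 : 1 / (4 * (k : ℝ) ^ 2) ≤ 1 / l - 1 / k := by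
      rw [div_sub_div _ _ hl0.ne' hk0.ne', div_le_div_iff₀ (by positivity) (by positivity)]
      nlinarith
    linarith
  · left
    rwa [add_sub_cancel_left, abs_of_nonneg hje0]
  · right
    have hlk : (k : ℝ) + 1 ≤ l := by exact_mod_cast h
    rw [abs_sub_comm]
    refine le_trans ?_ (le_abs_self _)
    -- The `l`-th cluster extends from `1 / l` towards `1 / k`, so its width must be subtracted from
    -- the gap.
    have h1 : (l : ℝ) * Real.exp (-l) ≤ 1 / (4 * l ^ 2) := by
      rw [le_div_iff₀ (by positivity)]
      have := hN l (((le_max_left _ _).trans hk).trans h.le)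
      linarith [show (l : ℝ) * Real.exp (-l) * (4 * l ^ 2) = 4 * (l ^ 3 * Real.exp (-l)) by ring]
    have h2 : 1 / (4 * (l : ℝ) ^ 2) + 1 / (4 * (k : ℝ) ^ 2) ≤ 1 / k - 1 / l := by
      rw [div_add_div _ _ (by positivity) (by positivity), div_sub_div _ _ hk0.ne' hl0.ne',
        div_le_div_iff₀ (by positivity) (by positivity)]
      have h5 : (l : ℝ) ^ 2 + k ^ 2 ≤ 4 * k * l * (l - k) := by
        nlinarith [mul_nonneg (by linarith : (0 : ℝ) ≤ l - k - 1) (by positivity : (0 : ℝ) ≤ k * l),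
          mul_nonneg (by linarith : (0 : ℝ) ≤ l - k - 1) (by linarith : (0 : ℝ) ≤ k - 1),
          mul_nonneg (by linarith : (0 : ℝ) ≤ l - k - 1) (by linarith : (0 : ℝ) ≤ l - k - 1)]
      nlinarith [mul_le_mul_of_nonneg_left h5 (by positivity : (0 : ℝ) ≤ 4 * k * l)]
    linarith

theorem cluster_point_mem {k j : ℕ} (hk : 1 ≤ k) (hj : j ≤ k) :
    1 / (k : ℝ) + j * Real.exp (-k) ∈ clusterSet := Or.inr ⟨k, j, hk, hj, rfl⟩

/-! ### The contradiction from an extension operator -/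

theorem compRestrict_apply_of_mem {K : Set ℝ} {E : SmoothRestr 𝕜 K →L[𝕜] SmoothFun 𝕜}
    (hE : ∀ f, restrict 𝕜 K (E f) = f) (F : SmoothFun 𝕜) {x : ℝ} (hx : x ∈ K) :
    compRestrict E F x = F x :=
  congrFun (congrArg Subtype.val (hE (restrict 𝕜 K F))) ⟨x, hx⟩

theorem compRestrict_congr {K : Set ℝ} (E : SmoothRestr 𝕜 K →L[𝕜] SmoothFun 𝕜)
    {F G : SmoothFun 𝕜} (h : ∀ x ∈ K, F x = G x) : compRestrict E F = compRestrict E G := by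
  have : restrict 𝕜 K F = restrict 𝕜 K G := Subtype.ext (funext fun x => h x x.2)
  exact congrArg E this

theorem tendsto_natCast_pow_mul_exp_neg (m : ℕ) :
    Filter.Tendsto (fun k : ℕ => (k : ℝ) ^ m * Real.exp (-k)) Filter.atTop (nhds 0) :=
  (Real.tendsto_pow_mul_exp_neg_atTop_nhds_zero m).comp tendsto_natCast_atTop_atTop

/-- An extension operator would send truncated powers at the `k`-th cluster to functions
violating the interpolation inequality between derivatives. -/
theorem factorial_le_of_extension {E : SmoothRestr 𝕜 clusterSet →L[𝕜] SmoothFun 𝕜}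
    (hE : ∀ f, restrict 𝕜 clusterSet (E f) = f) :
    ∃ (n q r : ℕ) (A D : ℝ), ∀ᶠ k : ℕ in Filter.atTop, (n.factorial : ℝ) ≤
      A * ((k : ℝ) ^ (2 * q) * Real.exp (-k)) + A * (k : ℝ)⁻¹ + D * ((k : ℝ) ^ r * Real.exp (-k)) := by
  -- Index 1 because `‖·‖_0` sees only the point `0`. The power `p + 1` exceeds `p` by one, which
  -- leaves a factor `δ` in the bound for `G`.
  obtain ⟨p, C₀, hC₀, hp⟩ := exists_smoothSeminorm_le (compRestrict E) 1
  obtain ⟨q, C₁, hC₁, hq⟩ := exists_smoothSeminorm_le (compRestrict E) (p + 1 + 1)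
  obtain ⟨Ψ, C, hC, hΨ⟩ := exists_scaled_truncated_pow 𝕜 (p + 1)
  refine ⟨p + 1, q, (2 * q + 1) * (p + 1) + 1, (p + 1 : ℕ) * (C₁ * (C q * 8 ^ q)),
    2 ^ (p + 1) * (C₀ * C p), ?_⟩
  -- `k ≥ p + 2` supplies enough nodes and keeps the difference intervals inside `[1/k, 1]`; the
  -- bound `1 / 8` amounts to `δ ≤ δ'`.
  filter_upwards [clusterSet_separated, Filter.eventually_ge_atTop (p + 2),
    (tendsto_natCast_pow_mul_exp_neg 3).eventually_le_const (u := 1 / 8) (by norm_num)]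
    with k hsep hkp hk8
  have hk1 : (1 : ℝ) ≤ k := by exact_mod_cast (by omega : 1 ≤ k)
  have hk0 : (0 : ℝ) < k := by linarith
  have hkp' : ((p + 1 : ℕ) : ℝ) + 1 ≤ k := by exact_mod_cast hkp
  set ε : ℝ := Real.exp (-k) with hε
  have hε0 : 0 < ε := Real.exp_pos _
  set a : ℝ := 1 / k with ha
  set δ : ℝ := k * ε with hδ
  set δ' : ℝ := 1 / (8 * (k : ℝ) ^ 2) with hδ'
  have hδ0 : 0 < δ := by positivity
  have hδ'0 : 0 < δ' := by positivity
  have hδδ' : δ ≤ δ' := by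
    rw [hδ, hδ', le_div_iff₀ (by positivity)]
    linarith [show (k : ℝ) * ε * (8 * k ^ 2) = 8 * (k ^ 3 * ε) by ring]
  have hδ'1 : δ' ≤ 1 := by
    rw [hδ', div_le_one (by positivity)]
    nlinarith
  obtain ⟨hpow, hzero, hbd⟩ := hΨ a δ hδ0
  obtain ⟨hpow', hzero', hbd'⟩ := hΨ a δ' hδ'0
  set G := compRestrict E (Ψ a δ') with hG
  -- No point of the set has distance strictly between `δ` and `2 * δ' = 1 / (4 * k ^ 2)` from `a`,
  -- so the two cutoffs agree on it.
  have hG' : G = compRestrict E (Ψ a δ) := compRestrict_congr E fun x hx => by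
    rcases hsep x hx with h | h
    · rw [hpow x h, hpow' x (h.trans hδδ')]
    · have h2 : 2 * δ' ≤ |x - a| :=
        le_trans (le_of_eq (by rw [hδ']; field_simp; norm_num)) h
      rw [hzero' x h2, hzero x (by linarith)]
  have hS : ∀ y ∈ Set.Icc a 1, ‖G y‖ ≤ C₀ * C p * δ := fun y hy => by
    have h1 := norm_iteratedDeriv_le_smoothSeminorm (n := 1) (j := 0) zero_le_one G (x := y)
      ⟨by push_cast; linarith [hy.1, (by positivity : 0 < a)], by simpa using hy.2⟩
    rw [iteratedDeriv_zero, hG'] at h1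
    rw [hG']
    refine h1.trans ((hp _).trans ?_)
    rw [mul_assoc]
    refine mul_le_mul_of_nonneg_left ((hbd (hδδ'.trans hδ'1) p).trans (le_of_eq ?_)) hC₀
    rw [pow_succ, mul_right_comm (δ ^ p), ← mul_pow, mul_inv_cancel₀ hδ0.ne', one_pow, one_mul]
  have hB : ∀ y ∈ Set.Icc a 1,
      ‖iteratedDeriv (p + 1 + 1) G y‖ ≤ C₁ * (C q * 8 ^ q) * (k : ℝ) ^ (2 * q) := fun y hy => by
    have h1 := norm_iteratedDeriv_le_smoothSeminorm le_rfl G (x := y) (n := p + 1 + 1)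
      ⟨by push_cast; linarith [hy.1, (by positivity : 0 < a), (p.cast_nonneg : (0 : ℝ) ≤ p)],
       by push_cast; linarith [hy.2, (p.cast_nonneg : (0 : ℝ) ≤ p)]⟩
    refine h1.trans ((hq _).trans ?_)
    rw [mul_assoc, mul_assoc]
    refine mul_le_mul_of_nonneg_left ((hbd' hδ'1 q).trans ?_) hC₁
    refine mul_le_mul_of_nonneg_left ?_ (hC q)
    have h2 : δ'⁻¹ ^ q = 8 ^ q * (k : ℝ) ^ (2 * q) := by
      rw [hδ', one_div, inv_inv, mul_pow, pow_mul]
    rw [h2]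
    exact mul_le_of_le_one_left (by positivity) (pow_le_one₀ hδ'0.le hδ'1)
  have hle : ∀ t : ℝ, t ≤ a → a + (p + 1 : ℕ) * t ≤ 1 := fun t ht => by
    have h1 : (((p + 1 : ℕ) : ℝ) + 1) * a ≤ k * a := by gcongr
    rw [ha, mul_one_div_cancel hk0.ne', ← ha] at h1
    have h2 : ((p + 1 : ℕ) : ℝ) * t ≤ (p + 1 : ℕ) * a := by gcongr
    linarith
  have hεa : ε ≤ a := by
    rw [ha, le_div_iff₀ hk0, mul_comm]
    exact hδδ'.trans hδ'1
  have hha : ((k : ℝ) ^ (2 * q + 1))⁻¹ ≤ a := by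
    rw [ha, one_div]
    exact inv_anti₀ hk0 (le_self_pow₀ hk1 (by omega))
  -- With this `h`, the term `h * B` is of order `1 / k`, while `h⁻¹ ^ (p + 1)` is still polynomial
  -- in `k` and loses against the exponentially small `δ`.
  have key := factorial_le_of_eq_pow (p + 1) G.contDiff (x := a) hε0
    (h := ((k : ℝ) ^ (2 * q + 1))⁻¹) (by positivity) (hle _ hεa) (hle _ hha) hB hS
    fun j hj => by
      have hjk : j ≤ k := by omega
      rw [hG, compRestrict_apply_of_mem hE _ (cluster_point_mem (by omega) hjk),
        hpow' _ ?_, add_sub_cancel_left]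
      rw [add_sub_cancel_left, abs_of_nonneg (by positivity)]
      refine le_trans ?_ hδδ'
      exact mul_le_mul_of_nonneg_right (by exact_mod_cast hjk) hε0.le
  refine key.trans (le_of_eq ?_)
  have h3 : ((k : ℝ) ^ (2 * q + 1))⁻¹ * (k : ℝ) ^ (2 * q) = (k : ℝ)⁻¹ := by
    rw [pow_succ, mul_inv, mul_right_comm, inv_mul_cancel₀ (by positivity), one_mul]
  have h4 : (k : ℝ) ^ ((2 * q + 1) * (p + 1) + 1) = ((k : ℝ) ^ (2 * q + 1)) ^ (p + 1) * k := by
    rw [pow_succ, pow_mul]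
  rw [inv_inv, h4, ← h3, hδ]
  ring

end SmoothExtension

end

theorem mainTheorem12 (𝕜 : Type*) [RCLike 𝕜] :
    ¬ SmoothExtension.HasSmoothExtensionProperty 𝕜 SmoothExtension.clusterSet := by
  rintro ⟨E, hE⟩
  obtain ⟨n, q, r, A, D, h⟩ := SmoothExtension.factorial_le_of_extension hE
  have hlim := (((SmoothExtension.tendsto_natCast_pow_mul_exp_neg (2 * q)).const_mul A).add
    ((tendsto_inv_atTop_nhds_zero_nat (𝕜 := ℝ)).const_mul A)).add
    ((SmoothExtension.tendsto_natCast_pow_mul_exp_neg r).const_mul D)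
  have h0 := ge_of_tendsto hlim h
  simp only [mul_zero, add_zero] at h0
  exact absurd h0 (not_le.2 (by exact_mod_cast n.factorial_pos))
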